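/- Let $d,J\in\mathbb N$ with $1\le d\le J$, let $A\in\mathbb R^{dJ\times dJ}$ be symmetric positive semi-definite, and let $Y$ be a random matrix in $\mathbb R^{d\times J}$ whose column-wise vectorisation satisfies $\operatorname{vec}(Y)\sim N(0,A)$ (a centred Gaussian matrix). Denote by $\lambda_{\min}(S)$ the smallest eigenvalue of a real symmetric matrix $S$. (i) If $A$ is positive definite, then for every $\tau\ge 0$ $$\mathbb P\Big(\lambda_{\min}(YY^\top)\le \tau (J-d+2)\lambda_{\min}(A)\Big)\le (2^{d+1}e)^{1/2}\,(2ed\tau)^{(J-d+1)/2}.$$ (ii) For every $\delta\in(0,1)$, with probability at least $1-\delta$, $$\lambda_{\min}(YY^\top)\ge e^{-2}\,2^{-d-2}\,\delta^{2/(J-d+1)}\,(J-d+2)\,\lambda_{\min}(A).$$ -/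

import Mathlib

open MeasureTheory ProbabilityTheory
open scoped Matrix

/-- The smallest eigenvalue of a real symmetric matrix: the minimum of its spectrum, which is a
finite set, non-empty as soon as the index type is non-empty. -/
noncomputable def lambdaMin {n : Type*} [Fintype n] [DecidableEq n] (M : Matrix n n ℝ) : ℝ :=
  sInf (spectrum ℝ M)

/-- For a symmetric matrix, `lambdaMin` is the least of its (real) eigenvalues. -/
theorem isLeast_lambdaMin {n : Type*} [Fintype n] [DecidableEq n] [Nonempty n]
    {M : Matrix n n ℝ} (hM : M.IsHermitian) :
    IsLeast (Set.range hM.eigenvalues) (lambdaMin M) := by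
  unfold lambdaMin
  rw [hM.spectrum_real_eq_range_eigenvalues]
  have hfin := Set.finite_range hM.eigenvalues
  exact ⟨(Set.range_nonempty _).csInf_mem hfin, fun _ hx => csInf_le hfin.bddBelow hx⟩

/-! If `λ_min(YYᵀ) ≤ s`, divide a minimal eigenvector by its entry of largest modulus: this gives
`v` with `v i = 1`, `|v j| ≤ 1` and `‖Yᵀv‖² ≤ d s`, so row `i` is within `√(d s)` of the span of the
other rows (`exists_mem_nearDependent`). As `A ≥ λ_min(A) I`, row `i` contains an independent
Gaussian part of variance `λ_min(A)` (`multivariateGaussian_eq_conv_singleRow`). With the rest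
fixed, project orthogonally to the other rows: a shifted Gaussian in dimension at least `m = J - d +
1` must be small, and a Chernoff bound controls this (`stdGaussian_real_norm_sq_le`). A union bound
over `i` costs a factor `d`. What remains is a comparison of constants. Part (ii) uses the bound
before it is weakened to the form in (i), which would lose a factor `√d` when `m = 1`. -/

/-! ### Laplace transforms and small balls of Gaussian vectors -/

/-- Noncentral chi-square Laplace transform in one dimension, compared with the central one. -/
theorem integral_exp_neg_mul_sq_gaussianReal_le {l : ℝ} (hl : 0 ≤ l) (s z : ℝ) :
    ∫ x, Real.exp (-(l * (z + s * x) ^ 2)) ∂(gaussianReal 0 1) ≤ (√(1 + 2 * l * s ^ 2))⁻¹ := by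
  have ha : 0 < l * s ^ 2 + 1 / 2 := by positivity
  set a := l * s ^ 2 + 1 / 2 with ha_def
  rw [integral_gaussianReal_eq_integral_smul one_ne_zero]
  -- Completing the square: the shift `z` survives only in a prefactor at most `1` and in a
  -- translation of the integrand.
  have key (x : ℝ) : gaussianPDFReal 0 1 x • Real.exp (-(l * (z + s * x) ^ 2)) =
      ((√(2 * Real.pi))⁻¹ * Real.exp (-(l * z ^ 2 / (2 * a)))) *
        Real.exp (-a * (x + l * s * z / a) ^ 2) := by
    rw [gaussianPDFReal, smul_eq_mul, mul_assoc _ (Real.exp _), mul_assoc _ (Real.exp _),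
      ← Real.exp_add, ← Real.exp_add]
    congr 2
    · simp
    · have : -(l * z ^ 2 / (2 * a)) + -a * (x + l * s * z / a) ^ 2 =
          -(l * z ^ 2 * (1 / 2 + l * s ^ 2) / a + 2 * l * s * z * x + a * x ^ 2) := by
        field_simp
        ring
      rw [this, show 1 / 2 + l * s ^ 2 = a by rw [ha_def]; ring, mul_div_cancel_right₀ _ ha.ne',
        ha_def]
      push_cast
      ring
  simp_rw [key]
  rw [integral_const_mul, integral_add_right_eq_self (fun x => Real.exp (-a * x ^ 2)),
    integral_gaussian]
  have h1 : Real.exp (-(l * z ^ 2 / (2 * a))) ≤ 1 := by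
    rw [Real.exp_le_one_iff]
    have : 0 ≤ l * z ^ 2 / (2 * a) := by positivity
    linarith
  have h2 : (√(2 * Real.pi))⁻¹ * √(Real.pi / a) = (√(1 + 2 * l * s ^ 2))⁻¹ := by
    rw [← Real.sqrt_inv, ← Real.sqrt_inv, ← Real.sqrt_mul (by positivity)]
    congr 1
    rw [show 1 + 2 * l * s ^ 2 = 2 * a by rw [ha_def]; ring]
    have := Real.pi_pos
    field_simp
  calc _ = ((√(2 * Real.pi))⁻¹ * √(Real.pi / a)) * Real.exp (-(l * z ^ 2 / (2 * a))) := by ring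
    _ ≤ ((√(2 * Real.pi))⁻¹ * √(Real.pi / a)) * 1 := by gcongr
    _ = _ := by rw [mul_one, h2]

section StdGaussian

variable {E : Type*} [NormedAddCommGroup E] [InnerProductSpace ℝ E] [FiniteDimensional ℝ E]
  [MeasurableSpace E] [BorelSpace E]

/-- Laplace transform bound for the squared norm of a shifted Gaussian vector. -/
theorem integral_exp_neg_mul_norm_sq_stdGaussian_le {l : ℝ} (hl : 0 ≤ l) (s : ℝ) (z : E) :
    ∫ x, Real.exp (-(l * ‖z + s • x‖ ^ 2)) ∂(stdGaussian E) ≤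
      (√(1 + 2 * l * s ^ 2))⁻¹ ^ Module.finrank ℝ E := by
  set b := stdOrthonormalBasis ℝ E
  rw [stdGaussian, integral_map (Measurable.aemeasurable (by fun_prop))
    (Continuous.aestronglyMeasurable (by fun_prop))]
  have key (x : Fin (Module.finrank ℝ E) → ℝ) :
      Real.exp (-(l * ‖z + s • ∑ i, x i • b i‖ ^ 2)) =
        ∏ i, Real.exp (-(l * (inner ℝ (b i) z + s * x i) ^ 2)) := by
    rw [← Real.exp_sum, ← b.sum_sq_inner_right, Finset.mul_sum, ← Finset.sum_neg_distrib]
    congr 1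
    refine Finset.sum_congr rfl fun i _ => ?_
    rw [inner_add_right, inner_smul_right, b.orthonormal.inner_right_fintype]
  simp_rw [b] at key
  simp_rw [key]
  rw [integral_fintype_prod_eq_prod (f := fun i x =>
    Real.exp (-(l * (inner ℝ (stdOrthonormalBasis ℝ E i) z + s * x) ^ 2)))]
  refine (Finset.prod_le_prod (fun i _ => integral_nonneg fun _ => (Real.exp_pos _).le)
    fun i _ => integral_exp_neg_mul_sq_gaussianReal_le hl s _).trans ?_
  simp

/-- Small-ball estimate for a shifted Gaussian vector. -/
theorem stdGaussian_real_norm_sq_le {m : ℕ} (hm : 0 < m) (hmE : m ≤ Module.finrank ℝ E)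
    {s t : ℝ} (hs : 0 < s) (ht : 0 < t) (z : E) :
    (stdGaussian E).real {x | ‖z + s • x‖ ^ 2 ≤ t} ≤
      (Real.exp 1 * t / (m * s ^ 2)) ^ ((m : ℝ) / 2) := by
  have hm' : (0 : ℝ) < m := by exact_mod_cast hm
  -- Minimiser of `exp (l t) (2 l s²)^(-m/2)`, the Chernoff bound once the `1` under the root is
  -- dropped.
  set l : ℝ := m / (2 * t) with hl_def
  have hl : 0 ≤ l := by positivity
  have hint : Integrable (fun x : E => Real.exp (-l * ‖z + s • x‖ ^ 2)) (stdGaussian E) := by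
    refine Integrable.of_bound (Continuous.aestronglyMeasurable (by fun_prop)) 1
      (Filter.Eventually.of_forall fun x => ?_)
    rw [Real.norm_eq_abs, Real.abs_exp, Real.exp_le_one_iff]
    have : 0 ≤ l * ‖z + s • x‖ ^ 2 := by positivity
    linarith
  have hcher := measure_le_le_exp_mul_mgf (μ := stdGaussian E)
    (X := fun x => ‖z + s • x‖ ^ 2) t (neg_nonpos.2 hl) hint
  have hmgf : mgf (fun x => ‖z + s • x‖ ^ 2) (stdGaussian E) (-l) ≤
      (√(1 + 2 * l * s ^ 2))⁻¹ ^ Module.finrank ℝ E := by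
    rw [mgf]
    simpa only [neg_mul] using integral_exp_neg_mul_norm_sq_stdGaussian_le hl s z
  have hc : 2 * l * s ^ 2 = m * s ^ 2 / t := by
    rw [hl_def]; field_simp
  have hroot : (√(1 + 2 * l * s ^ 2))⁻¹ ^ Module.finrank ℝ E ≤ (√(m * s ^ 2 / t))⁻¹ ^ m := by
    rw [hc]
    have hp : 0 < m * s ^ 2 / t := by positivity
    have h1 : (√(1 + m * s ^ 2 / t))⁻¹ ≤ 1 :=
      inv_le_one_of_one_le₀ (Real.one_le_sqrt.2 (by linarith))
    refine (pow_le_pow_of_le_one (by positivity) h1 hmE).trans ?_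
    have : √(m * s ^ 2 / t) ≤ √(1 + m * s ^ 2 / t) := Real.sqrt_le_sqrt (by linarith)
    gcongr
  have hlt : -(-l) * t = m / 2 := by
    rw [hl_def]; field_simp
  rw [hlt] at hcher
  refine hcher.trans ((mul_le_mul_of_nonneg_left (hmgf.trans hroot) (Real.exp_pos _).le).trans ?_)
  apply le_of_eq
  rw [mul_div_assoc (Real.exp 1), Real.mul_rpow (Real.exp_pos _).le (by positivity),
    ← Real.exp_mul, one_mul]
  congr 1
  rw [← Real.sqrt_inv, inv_div, Real.sqrt_eq_rpow, ← Real.rpow_natCast, ← Real.rpow_mul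
    (by positivity)]
  congr 1
  ring

/-- Orthogonal projection onto a subspace maps the standard Gaussian to the standard Gaussian. -/
theorem map_orthogonalProjectionOnto_stdGaussian (W : Submodule ℝ E) :
    (stdGaussian E).map W.orthogonalProjectionOnto = stdGaussian W := by
  have : IsProbabilityMeasure ((stdGaussian E).map W.orthogonalProjectionOnto) :=
    Measure.isProbabilityMeasure_map (by fun_prop)
  apply Measure.ext_of_charFun
  ext w
  rw [charFun_stdGaussian, charFun_apply, integral_map (by fun_prop)
    (Continuous.aestronglyMeasurable (by fun_prop))]
  simp_rw [W.inner_orthogonalProjectionOnto_eq_of_mem_right]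
  rw [← charFun_apply, charFun_stdGaussian]
  simp

end StdGaussian

/-! ### Splitting off a Gaussian row -/

section RowDecomposition

variable {n k : Type*}

/-- The `i`-th row of a matrix given by its column-wise vectorisation. -/
noncomputable def vecRow (x : EuclideanSpace ℝ (n × k)) (i : k) : EuclideanSpace ℝ n :=
  WithLp.toLp 2 fun j => x (j, i)

/-- The vectorised matrix whose `i`-th row is `s • x` and whose other rows vanish. -/
noncomputable def singleRow [DecidableEq k] (i : k) (s : ℝ) (x : EuclideanSpace ℝ n) :
    EuclideanSpace ℝ (n × k) :=
  WithLp.toLp 2 fun p => if p.2 = i then s * x p.1 else 0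

@[fun_prop]
theorem continuous_vecRow (i : k) : Continuous fun x : EuclideanSpace ℝ (n × k) => vecRow x i := by
  unfold vecRow
  fun_prop

theorem vecRow_add (x y : EuclideanSpace ℝ (n × k)) (i : k) :
    vecRow (x + y) i = vecRow x i + vecRow y i := rfl

theorem vecRow_singleRow_self [DecidableEq k] (i : k) (s : ℝ) (x : EuclideanSpace ℝ n) :
    vecRow (singleRow i s x) i = s • x := by
  ext j
  simp [vecRow, singleRow]

theorem vecRow_singleRow_of_ne [DecidableEq k] {i j : k} (h : j ≠ i) (s : ℝ)
    (x : EuclideanSpace ℝ n) : vecRow (singleRow i s x) j = 0 := by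
  ext a
  simp [vecRow, singleRow, h]

@[fun_prop]
theorem continuous_singleRow [DecidableEq k] (i : k) (s : ℝ) :
    Continuous (singleRow (n := n) i s) := by
  unfold singleRow
  refine (PiLp.continuous_toLp 2 _).comp (continuous_pi fun p => ?_)
  split_ifs <;> fun_prop

variable [Fintype n] [Fintype k]

/-- Vectorised matrices with a linear combination of rows of small norm, in which the `i`-th row
has the largest coefficient, normalised to `1`. -/
def nearDependent (n : Type*) [Fintype n] (i : k) (r : ℝ) : Set (EuclideanSpace ℝ (n × k)) :=
  {x | ∃ v : k → ℝ, (v i = 1 ∧ ∀ j, |v j| ≤ 1) ∧ ‖∑ j, v j • vecRow x j‖ ^ 2 ≤ r}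

/-- Supplies measurability despite the uncountable union over `v`: the coefficients range over a
compact set, and projection along a compact factor is closed. -/
theorem isClosed_nearDependent (i : k) (r : ℝ) : IsClosed (nearDependent n i r) := by
  set K : Set (k → ℝ) := {v | v i = 1 ∧ ∀ j, |v j| ≤ 1} with hK
  have hKc : IsCompact K := by
    refine (isCompact_univ_pi fun _ : k => isCompact_Icc (a := (-1 : ℝ)) (b := 1)).of_isClosed_subset
      ?_ fun v hv j _ => abs_le.1 (hv.2 j)
    rw [hK, Set.ofPred_and, Set.ofPred_forall]
    exact (isClosed_eq (by fun_prop) (by fun_prop)).inter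
      (isClosed_iInter fun j => isClosed_le (by fun_prop) (by fun_prop))
  have : CompactSpace K := isCompact_iff_compactSpace.1 hKc
  have hcl : IsClosed {p : K × EuclideanSpace ℝ (n × k) |
      ‖∑ j, (p.1 : k → ℝ) j • vecRow p.2 j‖ ^ 2 ≤ r} := by
    have hrow (j : k) : Continuous fun p : K × EuclideanSpace ℝ (n × k) => vecRow p.2 j :=
      (continuous_vecRow j).comp continuous_snd
    have hcoeff (j : k) : Continuous fun p : K × EuclideanSpace ℝ (n × k) => (p.1 : k → ℝ) j :=
      (continuous_apply j).comp (continuous_subtype_val.comp continuous_fst)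
    exact isClosed_le ((continuous_finsetSum _ fun j _ => (hcoeff j).smul (hrow j)).norm.pow 2)
      continuous_const
  convert isClosedMap_snd_of_compactSpace _ hcl using 1
  ext x
  simp [nearDependent, hK]

variable [DecidableEq k]

theorem inner_singleRow (i : k) (s : ℝ) (x : EuclideanSpace ℝ n) (t : EuclideanSpace ℝ (n × k)) :
    inner ℝ (singleRow i s x) t = inner ℝ x (s • vecRow t i) := by
  simp only [PiLp.inner_apply, singleRow, vecRow, Fintype.sum_prod_type]
  refine Finset.sum_congr rfl fun j _ => ?_
  rw [Finset.sum_eq_single i]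
  · simp; ring
  · intro b _ hb; simp [hb]
  · simp

/-- The covariance of `singleRow i s g` for a standard Gaussian vector `g`. -/
def singleRowCov (n : Type*) [DecidableEq n] (i : k) (s : ℝ) : Matrix (n × k) (n × k) ℝ :=
  Matrix.diagonal fun p => if p.2 = i then s ^ 2 else 0

theorem dotProduct_singleRowCov [DecidableEq n] (i : k) (s : ℝ) (t : EuclideanSpace ℝ (n × k)) :
    t ⬝ᵥ singleRowCov n i s *ᵥ t = ‖s • vecRow t i‖ ^ 2 := by
  rw [norm_smul, mul_pow, EuclideanSpace.real_norm_sq_eq]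
  simp only [singleRowCov, vecRow, dotProduct, Matrix.mulVec_diagonal, Fintype.sum_prod_type,
    Finset.mul_sum, Real.norm_eq_abs, sq_abs]
  refine Finset.sum_congr rfl fun j _ => ?_
  rw [Finset.sum_eq_single i]
  · simp; ring
  · intro b _ hb; simp [hb]
  · simp

/-- A centred Gaussian splits off an independent Gaussian row. -/
theorem multivariateGaussian_eq_conv_singleRow [DecidableEq n] {A : Matrix (n × k) (n × k) ℝ}
    (hA : A.PosSemidef) (i : k) (s : ℝ) (hB : (A - singleRowCov n i s).PosSemidef) :
    multivariateGaussian 0 A =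
      multivariateGaussian 0 (A - singleRowCov n i s) ∗
        (stdGaussian (EuclideanSpace ℝ n)).map (singleRow i s) := by
  have : IsProbabilityMeasure ((stdGaussian (EuclideanSpace ℝ n)).map (singleRow (k := k) i s)) :=
    Measure.isProbabilityMeasure_map (by fun_prop)
  apply Measure.ext_of_charFun
  ext t
  rw [charFun_conv, charFun_multivariateGaussian hA, charFun_multivariateGaussian hB]
  rw [charFun_apply (μ := Measure.map _ _), integral_map (by fun_prop)
    (Continuous.aestronglyMeasurable (by fun_prop))]
  simp_rw [inner_singleRow]
  rw [← charFun_apply, charFun_stdGaussian, ← Complex.exp_add]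
  congr 1
  rw [Matrix.sub_mulVec, dotProduct_sub, dotProduct_singleRowCov]
  push_cast
  simp
  ring

theorem posSemidef_sub_lambdaMin {m : Type*} [Fintype m] [DecidableEq m] {M : Matrix m m ℝ}
    (hM : M.IsHermitian) : (M - lambdaMin M • (1 : Matrix m m ℝ)).PosSemidef := by
  open scoped MatrixOrder in
  rw [← Matrix.le_iff, ← Algebra.algebraMap_eq_smul_one]
  rw [algebraMap_le_iff_le_spectrum (ha := hM.isSelfAdjoint)]
  intro x hx
  exact csInf_le (Matrix.finite_real_spectrum.bddBelow) hx

/-- `A ≥ λ_min(A) I`, and zeroing diagonal entries of the latter only decreases it. -/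
theorem posSemidef_sub_singleRowCov [DecidableEq n] {A : Matrix (n × k) (n × k) ℝ}
    (hA : A.IsHermitian) (i : k) {s : ℝ} (hs : s ^ 2 = lambdaMin A) : (A - singleRowCov n i s).PosSemidef := by
  have h : (lambdaMin A • (1 : Matrix (n × k) (n × k) ℝ) - singleRowCov n i s).PosSemidef := by
    rw [← hs, singleRowCov, Matrix.smul_one_eq_diagonal, Matrix.diagonal_sub]
    refine Matrix.PosSemidef.diagonal fun p => ?_
    simp only [Pi.zero_apply]
    split_ifs
    · simp
    · simpa using sq_nonneg s
  simpa using (posSemidef_sub_lambdaMin hA).add h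

/-- Conditionally on the other rows, a random matrix with a Gaussian `i`-th row is unlikely to be
nearly dependent. -/
theorem stdGaussian_real_nearDependent_le {m : ℕ} (hm : 0 < m)
    (hmk : m + Fintype.card k ≤ Fintype.card n + 1) (i : k) {s r : ℝ} (hs : 0 < s) (hr : 0 < r)
    (z : EuclideanSpace ℝ (n × k)) :
    (stdGaussian (EuclideanSpace ℝ n)).real {g | z + singleRow i s g ∈ nearDependent n i r} ≤
      (Real.exp 1 * r / (m * s ^ 2)) ^ ((m : ℝ) / 2) := by
  -- Row `i` is left out, so `V` does not depend on `g`.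
  set V : Submodule ℝ (EuclideanSpace ℝ n) :=
    Submodule.span ℝ (Set.range fun j : {j // j ≠ i} => vecRow z j) with hV
  have hVr : Module.finrank ℝ V ≤ Fintype.card k - 1 := by
    refine (finrank_range_le_card (R := ℝ) fun j : {j // j ≠ i} => vecRow z j).trans ?_
    rw [Fintype.card_subtype_compl]
    simp
  have hVW := V.finrank_add_finrank_orthogonal
  rw [finrank_euclideanSpace] at hVW
  have hk : 0 < Fintype.card k := Fintype.card_pos_iff.2 ⟨i⟩
  have hW : m ≤ Module.finrank ℝ Vᗮ := by omega
  have hmain := stdGaussian_real_norm_sq_le hm hW hs hr (Vᗮ.orthogonalProjectionOnto (vecRow z i))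
  rw [← map_orthogonalProjectionOnto_stdGaussian, map_measureReal_apply (by fun_prop)
    (measurableSet_le (by fun_prop) (by fun_prop))] at hmain
  refine le_trans (measureReal_mono ?_) hmain
  rintro g ⟨v, ⟨hvi, -⟩, hv⟩
  -- The projection kills the other rows, so the unknown coefficients `v j`, `j ≠ i`, disappear.
  have hproj : Vᗮ.orthogonalProjectionOnto (∑ j, v j • vecRow (z + singleRow i s g) j) =
      Vᗮ.orthogonalProjectionOnto (vecRow z i) + s • Vᗮ.orthogonalProjectionOnto g := by
    rw [map_sum, Finset.sum_eq_single i]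
    · rw [hvi, one_smul, vecRow_add, vecRow_singleRow_self, map_add, map_smul]
    · intro j _ hj
      rw [vecRow_add, vecRow_singleRow_of_ne hj, add_zero, map_smul]
      have : vecRow z j ∈ Vᗮᗮ := V.le_orthogonal_orthogonal
        (Submodule.subset_span ⟨⟨j, hj⟩, rfl⟩)
      rw [Submodule.orthogonalProjectionOnto_apply_of_mem_orthogonal this, smul_zero]
    · simp
  change ‖_ + s • Vᗮ.orthogonalProjectionOnto g‖ ^ 2 ≤ r
  rw [← hproj]
  refine le_trans ?_ hv
  gcongr
  exact Submodule.norm_orthogonalProjectionOnto_apply_le _ _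

theorem multivariateGaussian_real_nearDependent_le [DecidableEq n] {m : ℕ} (hm : 0 < m)
    (hmk : m + Fintype.card k ≤ Fintype.card n + 1) (i : k) {r : ℝ} (hr : 0 < r)
    {A : Matrix (n × k) (n × k) ℝ} (hA : A.PosSemidef) (hpos : 0 < lambdaMin A) :
    (multivariateGaussian 0 A).real (nearDependent n i r) ≤
      (Real.exp 1 * r / (m * lambdaMin A)) ^ ((m : ℝ) / 2) := by
  set s := √(lambdaMin A)
  have hs : 0 < s := Real.sqrt_pos.2 hpos
  have hs2 : s ^ 2 = lambdaMin A := Real.sq_sqrt hpos.le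
  have hmeas : MeasurableSet (nearDependent n i r) := (isClosed_nearDependent i r).measurableSet
  rw [← hs2, multivariateGaussian_eq_conv_singleRow hA i s
    (posSemidef_sub_singleRowCov hA.isHermitian i hs2)]
  refine ENNReal.toReal_le_of_le_ofReal (by positivity) ?_
  rw [← lintegral_indicator_one hmeas, Measure.lintegral_conv (measurable_one.indicator hmeas)]
  have hbound (z : EuclideanSpace ℝ (n × k)) :
      ∫⁻ y, (nearDependent n i r).indicator 1 (z + y)
        ∂((stdGaussian (EuclideanSpace ℝ n)).map (singleRow i s)) ≤
      ENNReal.ofReal ((Real.exp 1 * r / (m * s ^ 2)) ^ ((m : ℝ) / 2)) := by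
    rw [lintegral_map (by fun_prop (disch := assumption)) (by fun_prop)]
    have hset : MeasurableSet {g | z + singleRow i s g ∈ nearDependent n i r} :=
      (isClosed_nearDependent i r).measurableSet.preimage (by fun_prop)
    have hre := stdGaussian_real_nearDependent_le hm hmk i hs hr z
    rw [← ENNReal.ofReal_le_ofReal_iff (by positivity), ofReal_measureReal,
      ← lintegral_indicator_one hset] at hre
    exact hre
  refine (lintegral_mono hbound).trans ?_
  simp

end RowDecomposition

/-! ### Smallest eigenvalues of Gram matrices -/

theorem posSemidef_mul_transpose_self {k n : Type*} [Fintype k] [Fintype n]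
    (M : Matrix k n ℝ) : (M * Mᵀ).PosSemidef := by
  simpa using Matrix.posSemidef_self_mul_conjTranspose M

theorem lambdaMin_nonneg {k : Type*} [Fintype k] [DecidableEq k] [Nonempty k]
    {M : Matrix k k ℝ} (hM : M.PosSemidef) : 0 ≤ lambdaMin M := by
  obtain ⟨a, ha⟩ := (isLeast_lambdaMin hM.isHermitian).1
  exact ha ▸ hM.eigenvalues_nonneg a

theorem lambdaMin_pos {k : Type*} [Fintype k] [DecidableEq k] [Nonempty k]
    {M : Matrix k k ℝ} (hM : M.PosDef) : 0 < lambdaMin M := by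
  obtain ⟨a, ha⟩ := (isLeast_lambdaMin hM.isHermitian).1
  exact ha ▸ hM.eigenvalues_pos a

theorem lambdaMin_eq_zero_of_not_posDef {k : Type*} [Fintype k] [DecidableEq k] [Nonempty k]
    {M : Matrix k k ℝ} (hM : M.PosSemidef) (h : ¬ M.PosDef) : lambdaMin M = 0 := by
  refine le_antisymm (not_lt.1 fun hpos => h ?_) (lambdaMin_nonneg hM)
  exact hM.isHermitian.posDef_iff_eigenvalues_pos.2 fun a =>
    hpos.trans_le ((isLeast_lambdaMin hM.isHermitian).2 ⟨a, rfl⟩)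

/-- A matrix whose Gram matrix has a small eigenvalue has nearly dependent rows. -/
theorem exists_mem_nearDependent {k n : Type*} [Fintype k] [DecidableEq k] [Nonempty k] [Fintype n]
    (M : Matrix k n ℝ) {s : ℝ} (h : lambdaMin (M * Mᵀ) ≤ s) :
    ∃ i, WithLp.toLp 2 M.vec ∈ nearDependent n i (Fintype.card k * s) := by
  have hM := posSemidef_mul_transpose_self M
  have hH := hM.isHermitian
  have hnn := lambdaMin_nonneg hM
  obtain ⟨a, ha⟩ := (isLeast_lambdaMin hH).1
  set u : EuclideanSpace ℝ k := hH.eigenvectorBasis a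
  have hu : (M * Mᵀ) *ᵥ u = lambdaMin (M * Mᵀ) • (u : k → ℝ) := by
    rw [← ha]
    exact hH.mulVec_eigenvectorBasis a
  have hu0 : u ≠ 0 := hH.eigenvectorBasis.orthonormal.ne_zero a
  obtain ⟨i, hi⟩ := Finite.exists_max fun j => |u j|
  have hui : u i ≠ 0 := by
    intro h0
    refine hu0 (PiLp.ext fun j => ?_)
    simpa [h0] using hi j
  set v : k → ℝ := (u i)⁻¹ • (u : k → ℝ) with hv
  have hv1 : ∀ j, |v j| ≤ 1 := fun j => by
    rw [hv, Pi.smul_apply, smul_eq_mul, abs_mul, abs_inv, inv_mul_le_one₀ (abs_pos.2 hui)]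
    exact hi j
  have hMv : (M * Mᵀ) *ᵥ v = lambdaMin (M * Mᵀ) • v := by
    rw [hv, Matrix.mulVec_smul, hu, smul_comm]
  refine ⟨i, v, ⟨by simp [hv, hui], hv1⟩, ?_⟩
  have hnorm : ‖∑ j, v j • vecRow (WithLp.toLp 2 M.vec) j‖ ^ 2 = v ⬝ᵥ (M * Mᵀ) *ᵥ v := by
    rw [EuclideanSpace.real_norm_sq_eq, ← Matrix.mulVec_mulVec, Matrix.dotProduct_mulVec,
      ← Matrix.mulVec_transpose, dotProduct]
    refine Finset.sum_congr rfl fun b _ => ?_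
    rw [sq]
    simp [vecRow, Matrix.mulVec, dotProduct, mul_comm, Matrix.vec]
  rw [hnorm, hMv, dotProduct_smul, smul_eq_mul, mul_comm]
  have hvv : v ⬝ᵥ v ≤ Fintype.card k := by
    rw [dotProduct]
    refine (Finset.sum_le_sum fun j _ => (?_ : v j * v j ≤ 1)).trans (by simp)
    rw [← sq]
    exact (sq_le_one_iff_abs_le_one _).2 (hv1 j)
  exact mul_le_mul hvv h hnn (Nat.cast_nonneg _)

/-! ### Union bound and lower tail -/

section LowerTail

variable {Ω : Type*} [MeasurableSpace Ω] {P : Measure Ω} [IsProbabilityMeasure P]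
  {k n : Type*} [Fintype k] [DecidableEq k] [Nonempty k] [Fintype n] [DecidableEq n]
  {A : Matrix (n × k) (n × k) ℝ} {Y : Ω → Matrix k n ℝ} {m : ℕ}

/-- Lower tail of the smallest eigenvalue of the Gram matrix of a Gaussian matrix. -/
theorem measureReal_lambdaMin_gram_le (hm : 0 < m) (hmk : m + Fintype.card k ≤ Fintype.card n + 1)
    (hA : A.PosSemidef) (hpos : 0 < lambdaMin A)
    (hY : HasLaw (fun ω => WithLp.toLp 2 (Y ω).vec) (multivariateGaussian 0 A) P)
    {s : ℝ} (hs : 0 ≤ s) :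
    P.real {ω | lambdaMin (Y ω * (Y ω)ᵀ) ≤ s} ≤ Fintype.card k *
      (Real.exp 1 * (Fintype.card k * s) / (m * lambdaMin A)) ^ ((m : ℝ) / 2) := by
  have hcard : (0 : ℝ) < Fintype.card k := by exact_mod_cast Fintype.card_pos
  have hstep : ∀ t : ℝ, 0 < t → P.real {ω | lambdaMin (Y ω * (Y ω)ᵀ) ≤ t} ≤ Fintype.card k *
      (Real.exp 1 * (Fintype.card k * t) / (m * lambdaMin A)) ^ ((m : ℝ) / 2) := by
    intro t ht
    calc P.real {ω | lambdaMin (Y ω * (Y ω)ᵀ) ≤ t}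
        ≤ P.real (⋃ i, {ω | WithLp.toLp 2 (Y ω).vec ∈ nearDependent n i (Fintype.card k * t)}) :=
          measureReal_mono fun ω hω => Set.mem_iUnion.2 (exists_mem_nearDependent (Y ω) hω)
      _ ≤ ∑ i, P.real {ω | WithLp.toLp 2 (Y ω).vec ∈ nearDependent n i (Fintype.card k * t)} :=
          measureReal_iUnion_fintype_le _
      _ ≤ ∑ _i : k, (Real.exp 1 * (Fintype.card k * t) / (m * lambdaMin A)) ^ ((m : ℝ) / 2) := by
          refine Finset.sum_le_sum fun i _ => ?_
          refine le_trans (le_of_eq ?_)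
            (multivariateGaussian_real_nearDependent_le hm hmk i (mul_pos hcard ht) hA hpos)
          exact congrArg ENNReal.toReal
            (hY.measure_eq (isClosed_nearDependent i (Fintype.card k * t)).measurableSet)
      _ = _ := by simp
  -- The Chernoff parameter needs a positive radius; `s = 0` follows by letting `t ↓ 0`.
  rcases hs.eq_or_lt with rfl | hs
  · have hcont : Continuous fun t : ℝ => Fintype.card k *
        (Real.exp 1 * (Fintype.card k * t) / (m * lambdaMin A)) ^ ((m : ℝ) / 2) :=
      continuous_const.mul ((by fun_prop : Continuous fun t : ℝ =>
        Real.exp 1 * (Fintype.card k * t) / (m * lambdaMin A)).rpow_const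
          fun _ => Or.inr (by positivity))
    refine ge_of_tendsto (hcont.continuousWithinAt (s := Set.Ioi 0) (x := 0)) ?_
    filter_upwards [self_mem_nhdsWithin] with t ht
    exact (measureReal_mono fun ω (hω : _ ≤ (0 : ℝ)) => hω.trans (le_of_lt ht)).trans (hstep t ht)
  · exact hstep s hs

/-- From `1 + 1/m ≤ exp (1/m)`; this is the price of `m + 1 = J - d + 2` in place of `m` in the
threshold. -/
theorem one_add_one_div_rpow_half_le {m : ℕ} (hm : 0 < m) :
    (((m : ℝ) + 1) / m) ^ ((m : ℝ) / 2) ≤ Real.exp 1 ^ ((1 : ℝ) / 2) := by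
  have hm' : (0 : ℝ) < m := by exact_mod_cast hm
  calc (((m : ℝ) + 1) / m) ^ ((m : ℝ) / 2) ≤ Real.exp (1 / m) ^ ((m : ℝ) / 2) := by
        gcongr
        rw [add_div, div_self hm'.ne', add_comm]
        exact Real.add_one_le_exp _
    _ = _ := by
        rw [← Real.exp_mul, ← Real.exp_mul]
        congr 1
        field_simp

theorem measureReal_lambdaMin_gram_le_exp_mul (hm : 0 < m)
    (hmk : m + Fintype.card k ≤ Fintype.card n + 1)
    (hA : A.PosSemidef) (hpos : 0 < lambdaMin A)
    (hY : HasLaw (fun ω => WithLp.toLp 2 (Y ω).vec) (multivariateGaussian 0 A) P)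
    {τ : ℝ} (hτ : 0 ≤ τ) :
    P.real {ω | lambdaMin (Y ω * (Y ω)ᵀ) ≤ τ * ((m : ℝ) + 1) * lambdaMin A} ≤
      Fintype.card k * Real.exp 1 ^ ((1 : ℝ) / 2) *
        (Real.exp 1 * Fintype.card k * τ) ^ ((m : ℝ) / 2) := by
  have hm' : (0 : ℝ) < m := by exact_mod_cast hm
  refine (measureReal_lambdaMin_gram_le hm hmk hA hpos hY (by positivity)).trans ?_
  have : Real.exp 1 * (Fintype.card k * (τ * ((m : ℝ) + 1) * lambdaMin A)) / (m * lambdaMin A) =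
      (((m : ℝ) + 1) / m) * (Real.exp 1 * Fintype.card k * τ) := by
    field_simp
  rw [this, Real.mul_rpow (by positivity) (by positivity), ← mul_assoc]
  gcongr
  exact one_add_one_div_rpow_half_le hm

end LowerTail

/-! ### Comparison of constants -/

theorem cube_le_two_pow (d : ℕ) : d ^ 3 ≤ 2 ^ (d + 2) := by
  rcases le_or_gt d 4 with h | h
  · interval_cases d <;> norm_num
  · induction d, h using Nat.le_induction with
    | base => norm_num
    | succ d hd ih =>
      have h2 : (d + 1) ^ 3 ≤ 2 * d ^ 3 := by nlinarith [mul_self_nonneg (d - 5 : ℤ)]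
      calc (d + 1) ^ 3 ≤ 2 * d ^ 3 := h2
        _ ≤ 2 * 2 ^ (d + 2) := by gcongr
        _ = _ := by ring

/-- Since `m ≥ 1`, the factor `d` is absorbed by `d² ≤ 2^(d+2)`. -/
theorem tail_constant_le {d m : ℕ} (hm : 0 < m) {τ : ℝ} (hτ : 0 ≤ τ) :
    d * Real.exp 1 ^ ((1 : ℝ) / 2) * (Real.exp 1 * d * τ) ^ ((m : ℝ) / 2) ≤
      ((2 : ℝ) ^ (d + 1) * Real.exp 1) ^ ((1 : ℝ) / 2) *
        (2 * Real.exp 1 * d * τ) ^ ((m : ℝ) / 2) := by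
  have hm' : (1 : ℝ) ≤ m := by exact_mod_cast hm
  have hd : (d : ℝ) ≤ ((2 : ℝ) ^ (d + 1)) ^ ((1 : ℝ) / 2) * 2 ^ ((m : ℝ) / 2) := by
    have hsq : (d : ℝ) ^ 2 ≤ 2 ^ (d + 1) * 2 := by
      have : d ^ 2 ≤ 2 ^ (d + 2) := by
        refine le_trans ?_ (cube_le_two_pow d)
        rcases d.eq_zero_or_pos with rfl | h
        · simp
        · exact Nat.pow_le_pow_right h (by norm_num)
      rw [← pow_succ]
      exact_mod_cast this
    calc (d : ℝ) = ((d : ℝ) ^ 2) ^ ((1 : ℝ) / 2) := by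
          rw [← Real.sqrt_eq_rpow, Real.sqrt_sq (Nat.cast_nonneg d)]
      _ ≤ ((2 : ℝ) ^ (d + 1) * 2) ^ ((1 : ℝ) / 2) := by gcongr
      _ = ((2 : ℝ) ^ (d + 1)) ^ ((1 : ℝ) / 2) * 2 ^ ((1 : ℝ) / 2) :=
          Real.mul_rpow (by positivity) (by positivity)
      _ ≤ _ := by
          gcongr
          norm_num
  rw [show 2 * Real.exp 1 * d * τ = 2 * (Real.exp 1 * d * τ) by ring,
    Real.mul_rpow (by positivity) (Real.exp_pos _).le, Real.mul_rpow (x := 2) (by norm_num)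
    (by positivity)]
  calc _ ≤ (((2 : ℝ) ^ (d + 1)) ^ ((1 : ℝ) / 2) * 2 ^ ((m : ℝ) / 2)) *
        Real.exp 1 ^ ((1 : ℝ) / 2) * (Real.exp 1 * d * τ) ^ ((m : ℝ) / 2) := by gcongr
    _ = _ := by ring

/-- The power of `δ` becomes `δ` itself. The remaining base `b` is at most `1`, so `m = 1` is the
worst case, where the squared constant is exactly `d³ / 2^(d+2)`. -/
theorem quantile_constant_le {d m : ℕ} (hm : 0 < m) {δ : ℝ} (hδ : 0 ≤ δ) :
    d * Real.exp 1 ^ ((1 : ℝ) / 2) * (Real.exp 1 * d *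
      (Real.exp (-2) * (2 : ℝ) ^ (-(d : ℝ) - 2) * δ ^ ((2 : ℝ) / m))) ^ ((m : ℝ) / 2) ≤ δ := by
  have hm' : (1 : ℝ) ≤ m := by exact_mod_cast hm
  have h2 : (2 : ℝ) ^ (-(d : ℝ) - 2) = ((2 : ℝ) ^ (d + 2))⁻¹ := by
    rw [← Real.rpow_natCast, ← Real.rpow_neg (by norm_num)]
    congr 1
    push_cast
    ring
  have he : Real.exp (-2) = (Real.exp 1)⁻¹ * (Real.exp 1)⁻¹ := by
    rw [← Real.exp_neg, ← Real.exp_add]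
    norm_num
  have hcube : (d : ℝ) ^ 3 ≤ 2 ^ (d + 2) := by exact_mod_cast cube_le_two_pow d
  have hlin : (d : ℝ) ≤ 2 ^ (d + 2) := by
    exact_mod_cast (Nat.lt_two_pow_self.le.trans (Nat.pow_le_pow_right (by norm_num) (by omega)))
  set b : ℝ := (Real.exp 1)⁻¹ * (d * ((2 : ℝ) ^ (d + 2))⁻¹) with hb
  have hb0 : 0 ≤ b := by positivity
  have hb1 : b ≤ 1 := by
    refine mul_le_one₀ (inv_le_one_of_one_le₀ (Real.one_le_exp (by norm_num))) (by positivity) ?_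
    rw [← div_eq_mul_inv]
    exact div_le_one_of_le₀ hlin (by positivity)
  have hbase : Real.exp 1 * d * (Real.exp (-2) * (2 : ℝ) ^ (-(d : ℝ) - 2) * δ ^ ((2 : ℝ) / m)) =
      b * δ ^ ((2 : ℝ) / m) := by
    rw [h2, he, hb]
    field_simp
  rw [hbase, Real.mul_rpow hb0 (by positivity), ← Real.rpow_mul hδ,
    show (2 : ℝ) / m * (m / 2) = 1 by field_simp, Real.rpow_one, ← mul_assoc]
  refine mul_le_of_le_one_left hδ ?_
  calc d * Real.exp 1 ^ ((1 : ℝ) / 2) * b ^ ((m : ℝ) / 2)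
      ≤ d * Real.exp 1 ^ ((1 : ℝ) / 2) * b ^ ((1 : ℝ) / 2) := by
        refine mul_le_mul_of_nonneg_left ?_ (by positivity)
        exact Real.rpow_le_rpow_of_exponent_ge' hb0 hb1 (by positivity) (by gcongr)
    _ = ((d : ℝ) ^ 2 * Real.exp 1 * b) ^ ((1 : ℝ) / 2) := by
        rw [Real.mul_rpow (y := b) (by positivity) hb0,
          Real.mul_rpow (x := (d : ℝ) ^ 2) (by positivity) (by positivity),
          ← Real.sqrt_eq_rpow ((d : ℝ) ^ 2), Real.sqrt_sq (Nat.cast_nonneg d)]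
    _ ≤ 1 := by
        refine Real.rpow_le_one (by positivity) ?_ (by norm_num)
        rw [hb, show (d : ℝ) ^ 2 * Real.exp 1 * ((Real.exp 1)⁻¹ * (d * ((2 : ℝ) ^ (d + 2))⁻¹)) =
          d ^ 3 / 2 ^ (d + 2) by field_simp]
        exact div_le_one_of_le₀ hcube (by positivity)

/-! ### The two tail statements -/

theorem mainTheorem10
    {Ω : Type*} [MeasurableSpace Ω] (P : Measure Ω) [IsProbabilityMeasure P]
    (d J : ℕ) (hd : 1 ≤ d) (hdJ : d ≤ J)
    (A : Matrix (Fin J × Fin d) (Fin J × Fin d) ℝ) (hA : A.PosSemidef)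
    (Y : Ω → Matrix (Fin d) (Fin J) ℝ)
    (hY : HasLaw (fun ω => WithLp.toLp 2 (Y ω).vec) (multivariateGaussian 0 A) P) :
    (A.PosDef → ∀ τ : ℝ, 0 ≤ τ →
      P.real {ω | lambdaMin (Y ω * (Y ω)ᵀ) ≤ τ * ((J : ℝ) - d + 2) * lambdaMin A}
        ≤ ((2 : ℝ) ^ (d + 1) * Real.exp 1) ^ ((1 : ℝ) / 2)
            * (2 * Real.exp 1 * d * τ) ^ (((J : ℝ) - d + 1) / 2)) ∧
    (∀ δ : ℝ, 0 < δ → δ < 1 →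
      1 - δ ≤ P.real {ω | Real.exp (-2) * (2 : ℝ) ^ (-(d : ℝ) - 2)
            * δ ^ ((2 : ℝ) / ((J : ℝ) - d + 1)) * ((J : ℝ) - d + 2) * lambdaMin A
          ≤ lambdaMin (Y ω * (Y ω)ᵀ)}) := by
  have : Nonempty (Fin d) := ⟨⟨0, hd⟩⟩
  have : Nonempty (Fin J) := ⟨⟨0, hd.trans hdJ⟩⟩
  obtain ⟨m, hm, hmJ⟩ : ∃ m : ℕ, 0 < m ∧ m + d = J + 1 := ⟨J + 1 - d, by omega, by omega⟩
  have hmR : (J : ℝ) - d + 1 = m := by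
    have : (m : ℝ) + d = J + 1 := by exact_mod_cast hmJ
    linarith
  have hmR' : (J : ℝ) - d + 2 = m + 1 := by linarith
  have hmk : m + Fintype.card (Fin d) ≤ Fintype.card (Fin J) + 1 := by simp [hmJ]
  rw [hmR, hmR']
  refine ⟨fun hpd τ hτ => ?_, fun δ hδ _ => ?_⟩
  · have h := measureReal_lambdaMin_gram_le_exp_mul hm hmk hA (lambdaMin_pos hpd) hY hτ
    rw [Fintype.card_fin] at h
    exact h.trans (tail_constant_le hm hτ)
  -- For singular `A` the threshold is `0` and the event is certain.
  by_cases hpd : A.PosDef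
  · have h := measureReal_lambdaMin_gram_le_exp_mul hm hmk hA (lambdaMin_pos hpd) hY
      (τ := Real.exp (-2) * (2 : ℝ) ^ (-(d : ℝ) - 2) * δ ^ ((2 : ℝ) / m)) (by positivity)
    rw [Fintype.card_fin] at h
    have h' := h.trans (quantile_constant_le hm hδ.le)
    set c := Real.exp (-2) * (2 : ℝ) ^ (-(d : ℝ) - 2) * δ ^ ((2 : ℝ) / m) * ((m : ℝ) + 1) *
      lambdaMin A
    -- Covering by two events, rather than taking a complement, needs no measurability of
    -- `lambdaMin`.
    have hunion := measureReal_union_le (μ := P)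
      {ω | lambdaMin (Y ω * (Y ω)ᵀ) ≤ c} {ω | c ≤ lambdaMin (Y ω * (Y ω)ᵀ)}
    have huniv : {ω | lambdaMin (Y ω * (Y ω)ᵀ) ≤ c} ∪ {ω | c ≤ lambdaMin (Y ω * (Y ω)ᵀ)} =
        Set.univ :=
      Set.eq_univ_of_forall fun ω => le_total (lambdaMin (Y ω * (Y ω)ᵀ)) c
    rw [huniv, probReal_univ] at hunion
    linarith
  · have huniv : {ω | 0 ≤ lambdaMin (Y ω * (Y ω)ᵀ)} = Set.univ :=
      Set.eq_univ_of_forall fun ω => lambdaMin_nonneg (posSemidef_mul_transpose_self (Y ω))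
    rw [lambdaMin_eq_zero_of_not_posDef hA hpd, mul_zero, huniv, probReal_univ]
    linarith
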